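/- For a finite additive abelian group $G$ and a positive integer $k$, let $g^k(G)$ denote the smallest positive integer $\ell$ such that every subset $S\subseteq G$ with $|S|\ge \ell$ contains a subset $T\subseteq S$ with $|T|=k$ and $\sum_{x\in T}x=0$ (for $\ell>|G|$ the condition holds vacuously). Let $C_p$ be the cyclic group of prime order $p$. Let $p$ be a prime, let $k$ be an integer, and suppose that either $k=2m$ with $m\ge 2$ and $p>m^2$, or $k=2m+1$ with $m\ge 1$, $p>\frac{2m^3+5m^2-8m-3}{2(m+1)}$ and $p>k$. Let $p\equiv r\pmod k$. (i) If $k=2m$ is even and $r\in\{1,m+1,m+2,\dots,k-1\}$, then $$g^k(C_p)=\begin{cases}\frac{p-1}{k}+k,&\text{if } r=1,\\[2pt] \frac{p-r}{k}+k+1,&\text{if } r\ne 1.\end{cases}$$ (ii) If $k=2m+1$ is odd and $r\in\{1,\dots,k-1\}$, then $$\begin{cases} g^k(C_p)=\frac{p-1}{k}+k,&\text{if } r=1,\\[2pt] \frac{p-r}{k}+k\le g^k(C_p)\le \frac{p-r}{k}+k+1,&\text{if } r\ne 1.\end{cases}$$ -/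

import Mathlib

/-- `HarborthProperty G k l`: every set `S` of at least `l` elements of `G` contains a subset `T`
with exactly `k` (distinct) elements whose sum is zero. -/
def HarborthProperty (G : Type*) [AddCommGroup G] (k l : ℕ) : Prop :=
  ∀ S : Finset G, l ≤ S.card → ∃ T : Finset G, T ⊆ S ∧ T.card = k ∧ ∑ x ∈ T, x = 0

/-- The `k`-Harborth constant of `G`: the smallest positive integer `l` such that every subset of
`G` with at least `l` elements contains a zero-sum subset of size `k`. -/
noncomputable def kHarborth (G : Type*) [AddCommGroup G] (k : ℕ) : ℕ :=
  sInf {l : ℕ | 0 < l ∧ HarborthProperty G k l}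

/-- For a finite group the minimum exists, so that `kHarborth` is never a junk value. -/
theorem kHarborth_isLeast (G : Type*) [AddCommGroup G] [Fintype G] (k : ℕ) :
    IsLeast {l : ℕ | 0 < l ∧ HarborthProperty G k l} (kHarborth G k) := by
  have hne : {l : ℕ | 0 < l ∧ HarborthProperty G k l}.Nonempty :=
    ⟨Fintype.card G + 1, Nat.succ_pos _, fun S hS => by
      have := S.card_le_univ
      omega⟩
  exact ⟨Nat.sInf_mem hne, fun _ hl => Nat.sInf_le hl⟩

/-! For every `2 ≤ k < p` the constant is exactly `⌈(p - 1) / k⌉ + k`; both parts of the theorem are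
read off from this. Upper bound: the polynomial method behind the Dias da Silva–Hamidoune theorem.
With `s = ∑ Xᵢ` and `V` the Vandermonde determinant, `(1 - s ^ (p - 1)) * V` is nonzero only at
distinct coordinates of sum zero. Its top coefficients are Vandermonde determinants of the exponents
up to nonzero factors (`coeff_sum_X_pow_mul_det_vandermonde`), so the Combinatorial Nullstellensatz
yields such a point in `S ^ k`. Lower bound: the `k`-sums of a suitably translated interval fill too
short a range to reach `0`. -/

open MvPolynomial Finset

/-- Hermite's identity for natural number division. -/
lemma sum_range_add_div (N : ℕ) {k : ℕ} (hk : 0 < k) : ∑ i ∈ range k, (N + i) / k = N := by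
  induction N with
  | zero =>
    refine Finset.sum_eq_zero fun i hi => ?_
    rw [Nat.zero_add]
    exact Nat.div_eq_of_lt (mem_range.1 hi)
  | succ N ih =>
    -- Passing from `N` to `N + 1` drops the term `N / k` and gains `(N + k) / k = N / k + 1`.
    have h := Finset.sum_range_succ' (fun i => (N + i) / k) k
    rw [Finset.sum_range_succ, ih, Nat.add_div_right N hk, add_zero] at h
    have h' : ∑ i ∈ range k, (N + 1 + i) / k = ∑ i ∈ range k, (N + (i + 1)) / k :=
      Finset.sum_congr rfl fun i _ => by rw [add_right_comm, add_assoc]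
    omega

/-- Distinct exponents below `n` whose sum exceeds the least possible one by `N`. -/
lemma exists_injective_sum_eq {k n N : ℕ} (hk : 0 < k) (hkn : k ≤ n) (hN : N ≤ k * (n - k)) :
    ∃ c : Fin k → ℕ, Function.Injective c ∧ (∀ i, c i < n) ∧
      ∑ i, c i = N + ∑ i : Fin k, (i : ℕ) := by
  -- The excess `N` is spread as evenly as possible over `0, …, k - 1`, with larger shares last to
  -- keep the exponents increasing.
  refine ⟨fun i => (N + i) / k + i, StrictMono.injective fun i j hij => ?_, fun i => ?_, ?_⟩
  · exact add_lt_add_of_le_of_lt (Nat.div_le_div_right (by gcongr; exact hij.le)) hij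
  · have h : (N + i) / k < n - k + 1 := by
      rw [Nat.div_lt_iff_lt_mul hk, add_mul, mul_comm (n - k)]
      have := i.2
      omega
    have := i.2
    change (N + i) / k + i < n
    omega
  · rw [Finset.sum_add_distrib, Fin.sum_univ_eq_sum_range (fun i => (N + i) / k),
      sum_range_add_div N hk]

lemma det_vandermonde_X_eq_sum (R : Type*) [CommRing R] (k : ℕ) :
    (Matrix.vandermonde (X : Fin k → MvPolynomial (Fin k) R)).det =
      ∑ σ : Equiv.Perm (Fin k), (Equiv.Perm.sign σ : ℤ) •
        monomial (Finsupp.equivFunOnFinite.symm fun i => ((σ i : Fin k) : ℕ)) (1 : R) := by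
  rw [← Matrix.det_transpose, Matrix.det_apply]
  refine Finset.sum_congr rfl fun σ _ => ?_
  rw [Units.smul_def]
  congr 1
  rw [monomial_eq, Finsupp.prod_fintype _ _ (by simp)]
  simp [Matrix.vandermonde_apply]

lemma isHomogeneous_det_vandermonde_X (R : Type*) [CommRing R] (k : ℕ) :
    (Matrix.vandermonde (X : Fin k → MvPolynomial (Fin k) R)).det.IsHomogeneous
      (∑ i : Fin k, (i : ℕ)) := by
  rw [det_vandermonde_X_eq_sum]
  refine IsHomogeneous.sum _ _ _ fun σ _ => ?_
  refine Submodule.smul_of_tower_mem (homogeneousSubmodule (Fin k) R _) _ ?_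
  refine isHomogeneous_monomial _ ?_
  rw [Finsupp.degree_eq_sum]
  exact Equiv.sum_comp σ (fun i : Fin k => (i : ℕ))

/-- Multiplying a coefficient of `(∑ Xᵢ) ^ N * X ^ e` by the factorials of the exponents. -/
lemma coeff_sum_X_pow_mul_monomial {R ι : Type*} [CommRing R] [Fintype ι] (c e : ι →₀ ℕ) (N : ℕ)
    (h : ∑ i, c i = N + ∑ i, e i) :
    (∏ i, ((c i).factorial : R)) *
        coeff c ((∑ i, X i : MvPolynomial ι R) ^ N * monomial e 1) =
      N.factorial * ∏ i, ((c i).descFactorial (e i) : R) := by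
  classical
  rw [coeff_mul_monomial', mul_one]
  split_ifs with hle
  · have hs : ∑ i, (c - e) i = N := by
      have : ∑ i, c i = ∑ i, (c - e) i + ∑ i, e i := by
        rw [← Finset.sum_add_distrib]
        exact Finset.sum_congr rfl fun i _ => (Nat.sub_add_cancel (hle i)).symm
      omega
    rw [coeff_sum_X_pow_of_fintype, if_pos (by rwa [Finsupp.sum_fintype _ _ (by simp)]),
      Finsupp.multinomial_eq_of_support_subset (Finset.subset_univ _)]
    have hm := Nat.multinomial_spec univ (c - e : ι →₀ ℕ)
    rw [hs] at hm
    rw [← hm, ← Nat.cast_prod, ← Nat.cast_prod, ← Nat.cast_mul, ← Nat.cast_mul, mul_right_comm,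
      ← Finset.prod_mul_distrib]
    congr 2
    exact Finset.prod_congr rfl fun i _ => (Nat.factorial_mul_descFactorial (hle i)).symm
  -- The falling factorial vanishes as well, so the identity needs no condition `e ≤ c`.
  · obtain ⟨i, hi⟩ : ∃ i, c i < e i := by
      by_contra! hcon
      exact hle hcon
    rw [mul_zero, Finset.prod_eq_zero (mem_univ i), mul_zero]
    rw [Nat.descFactorial_of_lt hi, Nat.cast_zero]

/-- Expanding over permutations gives a determinant of falling factorials of the `c i`. These are
monic polynomials of degrees `0, …, k - 1`, so it equals the Vandermonde determinant. Keeping the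
factorials on the left avoids division. -/
lemma coeff_sum_X_pow_mul_det_vandermonde {R : Type*} [CommRing R] [IsDomain R] {k : ℕ} (c : Fin k →₀ ℕ)
    (N : ℕ) (h : ∑ i, c i = N + ∑ i : Fin k, (i : ℕ)) :
    (∏ i, ((c i).factorial : R)) *
        coeff c ((∑ i, X i : MvPolynomial (Fin k) R) ^ N * (Matrix.vandermonde X).det) =
      N.factorial * (Matrix.vandermonde fun i => (c i : R)).det := by
  rw [Matrix.det_eval_matrixOfPolynomials_eq_det_vandermonde (fun i => (c i : R))
    (fun i => descPochhammer R i) (fun i => descPochhammer_natDegree R i)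
    (fun i => monic_descPochhammer R i), det_vandermonde_X_eq_sum, ← Matrix.det_transpose,
    Matrix.det_apply, Finset.mul_sum, coeff_sum, Finset.mul_sum, Finset.mul_sum]
  refine Finset.sum_congr rfl fun σ _ => ?_
  rw [mul_smul_comm, coeff_smul, mul_smul_comm, coeff_sum_X_pow_mul_monomial, Units.smul_def,
    mul_smul_comm]
  · simp [descPochhammer_eval_eq_descFactorial]
  · rw [h]
    congr 1
    exact (Equiv.sum_comp σ (fun i : Fin k => (i : ℕ))).symm

/-- A set `S` in `ℤ/pℤ` with `p - 1 ≤ k (|S| - k)` contains `k` distinct elements of sum zero. -/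
lemma exists_zero_sum_subset {p : ℕ} [Fact p.Prime] {k : ℕ} (hk : 0 < k) (S : Finset (ZMod p))
    (hkS : k ≤ S.card) (hS : p - 1 ≤ k * (S.card - k)) :
    ∃ T ⊆ S, T.card = k ∧ ∑ x ∈ T, x = 0 := by
  classical
  have hp : p.Prime := Fact.out
  obtain ⟨c, hcinj, hclt, hcsum⟩ := exists_injective_sum_eq hk hkS hS
  have hSp : S.card ≤ p := by simpa [ZMod.card] using S.card_le_univ
  have hcp : ∀ i, c i < p := fun i => (hclt i).trans_le hSp
  set t : Fin k →₀ ℕ := Finsupp.equivFunOnFinite.symm c with ht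
  have htc : ∀ i, t i = c i := fun i => rfl
  set s : MvPolynomial (Fin k) (ZMod p) := ∑ i, X i with hs
  set V : MvPolynomial (Fin k) (ZMod p) := (Matrix.vandermonde X).det with hV
  have hVhom : V.IsHomogeneous (∑ i : Fin k, (i : ℕ)) := isHomogeneous_det_vandermonde_X _ k
  have hshom : s.IsHomogeneous 1 := IsHomogeneous.sum _ _ _ fun i _ => isHomogeneous_X _ i
  have hdeg : t.degree = p - 1 + ∑ i : Fin k, (i : ℕ) := by
    rw [Finsupp.degree_eq_sum, ← hcsum]
    rfl
  have hp1 := hp.one_lt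
  -- `p` does not divide `(p - 1)!`, and the exponents, distinct and below `p`, stay distinct mod
  -- `p`.
  have hcoeff : coeff t (s ^ (p - 1) * V) ≠ 0 := by
    intro h0
    have h := coeff_sum_X_pow_mul_det_vandermonde (R := ZMod p) t (p - 1) hcsum
    rw [← hs, ← hV, h0, mul_zero, eq_comm, mul_eq_zero, ZMod.natCast_eq_zero_iff,
      hp.dvd_factorial] at h
    rcases h with h | h
    · omega
    · refine Matrix.det_vandermonde_ne_zero_iff.2 (fun i j hij => hcinj ?_) h
      have := (ZMod.natCast_eq_natCast_iff' _ _ _).1 hij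
      rwa [htc, htc, Nat.mod_eq_of_lt (hcp i), Nat.mod_eq_of_lt (hcp j)] at this
  -- The degree of `V` is too small for it to contribute at `t`.
  have hcoeff' : coeff t (V - s ^ (p - 1) * V) ≠ 0 := by
    rw [coeff_sub, hVhom.coeff_eq_zero (by omega), zero_sub]
    exact neg_ne_zero.2 hcoeff
  have htot : (V - s ^ (p - 1) * V).totalDegree = t.degree := by
    refine le_antisymm ((totalDegree_sub _ _).trans (max_le ?_ ?_)) ?_
    · exact hVhom.totalDegree_le.trans (by omega)
    · rw [hdeg]
      simpa using ((hshom.pow (p - 1)).mul hVhom).totalDegree_le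
    · rw [Finsupp.degree_eq_sum]
      simpa [Finsupp.sum_fintype] using le_totalDegree (mem_support_iff.2 hcoeff')
  obtain ⟨x, hxS, hx⟩ := combinatorial_nullstellensatz_exists_eval_nonzero _ t hcoeff' htot
    (fun _ => S) hclt
  have hVx : eval x V = (Matrix.vandermonde x).det := by
    rw [hV, RingHom.map_det]
    congr 1
    ext i j
    simp [Matrix.vandermonde_apply]
  have hsx : eval x s = ∑ i, x i := by simp [hs]
  rw [map_sub, map_mul, map_pow, hVx, hsx, ← one_sub_mul, mul_ne_zero_iff,
    Matrix.det_vandermonde_ne_zero_iff] at hx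
  refine ⟨univ.image x, ?_, ?_, ?_⟩
  · exact Finset.image_subset_iff.2 fun i _ => hxS i
  · rw [Finset.card_image_of_injective _ hx.2, card_univ, Fintype.card_fin]
  · rw [Finset.sum_image hx.2.injOn]
    by_contra hne
    exact hx.1 (by rw [ZMod.pow_card_sub_one_eq_one hne, sub_self])

/-- A translate of an interval of length `l` in `ℤ/pℤ`, where `k (l - k) + 2 ≤ p`, need not contain
`k` distinct elements of sum zero. -/
lemma not_harborthProperty {p : ℕ} [Fact p.Prime] {k l : ℕ} (hk : 0 < k) (hkp : k < p)
    (hkl : k ≤ l) (hlp : l ≤ p) (hl : k * (l - k) + 2 ≤ p) : ¬ HarborthProperty (ZMod p) k l := by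
  classical
  have hk0 : (k : ZMod p) ≠ 0 := by
    rw [Ne, ZMod.natCast_eq_zero_iff]
    exact Nat.not_dvd_of_pos_of_lt hk hkp
  -- This shift gives the `k` smallest elements sum `1`; every `k`-sum is then represented in `[1, k
  -- * (l - k) + 1]`, below `p`.
  set a : ZMod p := (k : ZMod p)⁻¹ * (1 - ((∑ i ∈ range k, (i : ℤ) : ℤ) : ZMod p)) with ha
  set f : ℤ → ZMod p := fun i => a + i with hf
  have hinj : Set.InjOn f (Ico (0 : ℤ) l) := by
    intro x hx y hy hxy
    rw [coe_Ico, Set.mem_Ico] at hx hy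
    have h := (ZMod.intCast_eq_intCast_iff' _ _ _).1 (add_left_cancel hxy)
    rwa [Int.emod_eq_of_lt hx.1 (by omega), Int.emod_eq_of_lt hy.1 (by omega)] at h
  intro H
  obtain ⟨T, hTS, hTk, hT0⟩ := H ((Ico (0 : ℤ) l).image f) (by
    rw [Finset.card_image_of_injOn hinj]
    simp)
  obtain ⟨U, hU, rfl⟩ := Finset.subset_image_iff.1 hTS
  have hUinj : Set.InjOn f U := hinj.mono (by exact_mod_cast hU)
  rw [Finset.card_image_of_injOn hUinj] at hTk
  rw [Finset.sum_image hUinj, Finset.sum_add_distrib, Finset.sum_const, hTk, nsmul_eq_mul, ha,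
    mul_inv_cancel_left₀ hk0, ← Int.cast_sum] at hT0
  have hlow := Finset.sum_range_le_sum (s := U) (c := 0) fun x hx => (mem_Ico.1 (hU hx)).1
  have hupp := Finset.sum_le_sum_range (s := U) (c := (l : ℤ) - 1) fun x hx => by
    have := (mem_Ico.1 (hU hx)).2
    omega
  rw [hTk] at hlow hupp
  simp only [zero_add] at hlow
  have hrefl : ∑ n ∈ range k, ((l : ℤ) - 1 - n) = ∑ n ∈ range k, (n : ℤ) + k * (l - k) := by
    have h := Finset.sum_range_id_mul_two k
    have h' : (∑ n ∈ range k, (n : ℤ)) * 2 = k * (k - 1) := by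
      have := congrArg (Nat.cast : ℕ → ℤ) h
      push_cast [Nat.cast_sub hk] at this
      exact this
    rw [Finset.sum_sub_distrib]
    simp only [sum_const, card_range, nsmul_eq_mul]
    linarith
  have hl' : (k : ℤ) * (l - k) + 2 ≤ p := by
    have := (Nat.cast_le (α := ℤ)).2 hl
    push_cast [Nat.cast_sub hkl] at this
    exact this
  have hz : ((1 - ∑ i ∈ range k, (i : ℤ) + ∑ i ∈ U, i : ℤ) : ZMod p) = 0 := by
    push_cast at hT0 ⊢
    exact hT0
  have hdvd := Int.le_of_dvd (by linarith) ((ZMod.intCast_zmod_eq_zero_iff_dvd _ p).1 hz)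
  linarith

/-- The value of the `k`-Harborth constant of a group of prime order `p > k`. -/
theorem kHarborth_zmod_prime {p k : ℕ} (hp : p.Prime) (hk : 2 ≤ k) (hkp : k < p) :
    kHarborth (ZMod p) k = (p - 2) / k + 1 + k := by
  have : Fact p.Prime := ⟨hp⟩
  have hdiv := Nat.div_add_mod (p - 2) k
  have hmod := Nat.mod_lt (p - 2) (show 0 < k by omega)
  -- `k * q ≤ p - 2 < k * (q + 1)`: size `q + k` suits the interval, and size `q + k + 1` suits the
  -- upper bound.
  generalize (p - 2) / k = q at hdiv ⊢
  obtain ⟨⟨hpos, hprop⟩, hleast⟩ := kHarborth_isLeast (ZMod p) k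
  refine le_antisymm (hleast ⟨by omega, fun S hS => ?_⟩) ?_
  · refine exists_zero_sum_subset (by omega) S (by omega) ?_
    have : k * (q + 1) ≤ k * (S.card - k) := Nat.mul_le_mul_left k (by omega)
    rw [mul_add, mul_one] at this
    omega
  · by_contra! hlt
    refine not_harborthProperty (l := q + k) (by omega) hkp (by omega) ?_ ?_
      fun S hS => hprop S (by omega)
    · have : q + k ≤ k * q + 1 ∨ q = 0 := by
        rcases Nat.eq_zero_or_pos q with h | h
        · exact Or.inr h
        · exact Or.inl (by nlinarith)
      omega
    · rw [Nat.add_sub_cancel]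
      omega



theorem theorem3p11 (p k m r : ℕ) (hp : p.Prime) (hr : p ≡ r [MOD k]) :
    (k = 2 * m → 2 ≤ m → m ^ 2 < p → (r = 1 ∨ (m + 1 ≤ r ∧ r < k)) →
      (r = 1 → (kHarborth (ZMod p) k : ℚ) = ((p : ℚ) - 1) / k + k) ∧
      (r ≠ 1 → (kHarborth (ZMod p) k : ℚ) = ((p : ℚ) - r) / k + k + 1)) ∧
    (k = 2 * m + 1 → 1 ≤ m →
      (2 * (m : ℚ) ^ 3 + 5 * (m : ℚ) ^ 2 - 8 * m - 3) / (2 * ((m : ℚ) + 1)) < p →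
      k < p → (1 ≤ r ∧ r < k) →
      (r = 1 → (kHarborth (ZMod p) k : ℚ) = ((p : ℚ) - 1) / k + k) ∧
      (r ≠ 1 → ((p : ℚ) - r) / k + k ≤ (kHarborth (ZMod p) k : ℚ) ∧
        (kHarborth (ZMod p) k : ℚ) ≤ ((p : ℚ) - r) / k + k + 1)) := by
  have key : ∀ q : ℕ, 2 ≤ k → k < p → p = k * q + r → 1 ≤ r → r < k →
      (r = 1 → (kHarborth (ZMod p) k : ℚ) = ((p : ℚ) - 1) / k + k) ∧
      (r ≠ 1 → (kHarborth (ZMod p) k : ℚ) = ((p : ℚ) - r) / k + k + 1) := by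
    intro q hk hkp hpq hr1 hrk
    have hk0 : (k : ℚ) ≠ 0 := by positivity
    have hpQ : (p : ℚ) = k * q + r := by exact_mod_cast hpq
    have hval := kHarborth_zmod_prime hp hk hkp
    refine ⟨fun h => ?_, fun h => ?_⟩
    -- For `r = 1`, subtracting `2` crosses a multiple of `k`, lowering the quotient by one.
    · have hq : (p - 2) / k + 1 = q := by
        obtain ⟨q, rfl⟩ : ∃ q', q = q' + 1 :=
          Nat.exists_eq_succ_of_ne_zero (by rintro rfl; omega)
        rw [show p - 2 = k - 1 + k * q by rw [hpq, mul_add]; omega,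
          Nat.add_mul_div_left _ _ (by omega), Nat.div_eq_of_lt (by omega), zero_add]
      rw [hval, hq, hpQ, h]
      push_cast
      field_simp
      ring
    · have hq : (p - 2) / k = q := by
        rw [show p - 2 = r - 2 + k * q by omega, Nat.add_mul_div_left _ _ (by omega),
          Nat.div_eq_of_lt (by omega), zero_add]
      rw [hval, hq, hpQ]
      push_cast
      field_simp
      ring
  have hdecomp : r < k → p = k * (p / k) + r := fun h => by
    have := Nat.div_add_mod p k
    rw [hr, Nat.mod_eq_of_lt h] at this
    exact this.symm
  refine ⟨fun hk hm hmp hrr => ?_, fun hk hm _ hkp hrr => ?_⟩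
  · have hrk : r < k := by omega
    have hkp : k < p := by nlinarith
    exact key _ (by omega) hkp (hdecomp hrk) (by omega) hrk
  · obtain ⟨h1, h2⟩ := key _ (by omega) hkp (hdecomp hrr.2) hrr.1 hrr.2
    refine ⟨h1, fun h => ?_⟩
    -- The upper end of the claimed range is the exact value.
    rw [h2 h]
    exact ⟨by linarith, le_rfl⟩
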